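/- Let $L^2(\mathbb S^1)$ be the complex Hilbert space of square-integrable functions on the unit circle $\mathbb S^1\subset\mathbb R^2$ with arc length $\mathrm dv$ (total mass $2\pi$), where $v=(\cos\varphi,\sin\varphi)$. For $\phi\in L^2(\mathbb S^1)$ and $n=(n_1,n_2)\in\mathbb Z^2$ put $$R\phi=\phi-\frac1{2\pi}\int_{\mathbb S^1}\phi\,\mathrm dv,\qquad (J_n\phi)(v)=-i\,(v\cdot n)\,\phi(v),\qquad C_n=R-J_n,\qquad P_n(t)=e^{-C_nt}.$$ Thus $\partial_tf_n=-C_nf_n$, $t>0$, is the equation for the $n$-th Fourier mode in $x$ of the Lorentz kinetic equation $\partial_tf+v\cdot\nabla_xf=\frac1{2\pi}\int_{\mathbb S^1}f\,\mathrm dv-f$ on $\mathbb T^2\times\mathbb S^1$. Let $|n|$ denote the Euclidean norm. For a bounded accretive operator $C$ on a Hilbert space with $C_H=\frac12(C+C^*)$, the hypocoercivity index is the smallest integer $m\ge0$ (if it exists) such that $\sum_{j=0}^m(C^*)^jC_HC^j\ge\kappa I$ for some $\kappa>0$. Then: (a) For every $n\in\mathbb Z^2\setminus\{0\}$ the operator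 $C_n$ is accretive and its hypocoercivity index is $1$. Moreover there is a constant $\kappa>0$, independent of $n$, such that $$R+J_nRJ_n^*\ge\kappa I\qquad\text{for all } n\in\mathbb Z^2\setminus\{0\}.$$ (b) For every $n\in\mathbb Z^2\setminus\{0\}$, every solution $f_n$ of $\partial_tf_n=-C_nf_n$ (continuous on $[0,\infty)$ with values in $L^2(\mathbb S^1)$ and differentiable for $t>0$) and every $t\ge0$, $$\|f_n(t)\|\le\min\Big[1,\sqrt{\tfrac{2|n|+1}{2|n|-1}}\,e^{-\lambda_0t}\Big]\|f_n(0)\|\le\sqrt3\,e^{-\lambda_0t}\|f_n(0)\|,$$ where $\lambda_0=\frac12-\frac1{6\sqrt2}-\frac13\sqrt{\frac7{16}+\frac1{\sqrt8}}\approx0.0857$ (to four decimal places). (c) There are constants $c,\tau>0$, independent of $n$, such that for all $n\in\mathbb Z^2\setminus\{0\}$ $$\|P_n(t)\|\le1-c\,t^3,\qquad 0\le t\le\tau.$$ -/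

import Mathlib

open MeasureTheory
open scoped ENNReal InnerProductSpace

/-! ### Hypocoercivity index of a bounded accretive operator -/

noncomputable section HypocoercivityIndex

variable {H : Type*} [NormedAddCommGroup H] [InnerProductSpace ℂ H] [CompleteSpace H]

/-- A bounded operator is accretive if its numerical range lies in the right half-plane. -/
def IsAccretiveOp (C : H →L[ℂ] H) : Prop :=
  ∀ x : H, 0 ≤ (⟪C x, x⟫_ℂ).re

/-- The self-adjoint (Hermitian) part `(C + C*) / 2` of a bounded operator. -/
def hermitianPart (C : H →L[ℂ] H) : H →L[ℂ] H :=
  (1 / 2 : ℂ) • (C + C.adjoint)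

/-- `∑_{j=0}^m (C*)^j C_H C^j ≥ κ I` for some `κ > 0`; here `≤` is the Loewner order, i.e.
`A ≤ B` means that `B - A` is self-adjoint and nonnegative. -/
def HypocoerciveUpTo (C : H →L[ℂ] H) (m : ℕ) : Prop :=
  ∃ κ : ℝ, 0 < κ ∧
    (κ : ℂ) • (1 : H →L[ℂ] H) ≤
      ∑ j ∈ Finset.range (m + 1), C.adjoint ^ j * hermitianPart C * C ^ j

/-- `C` is accretive and its hypocoercivity index exists and equals `m`: `m` is the smallest
nonnegative integer for which the coercivity estimate `HypocoerciveUpTo C m` holds. -/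
def HasHypocoercivityIndex (C : H →L[ℂ] H) (m : ℕ) : Prop :=
  IsAccretiveOp C ∧ IsLeast {k : ℕ | HypocoerciveUpTo C k} m

end HypocoercivityIndex

/-! ### The Fourier modes of the Lorentz kinetic equation for `d = 2`, `σ = 1` -/

namespace Lorentz

noncomputable section

instance factTwoPiPos : Fact (0 < 2 * Real.pi) := ⟨Real.two_pi_pos⟩

/-- The circle `𝕊¹`, parametrized by the angle `φ ∈ ℝ / 2πℤ`; its measure `volume` is arc length
(total mass `2π`). -/
abbrev S1 : Type := AddCircle (2 * Real.pi)

/-- The complex Hilbert space `L²(𝕊¹)`. -/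
abbrev L2S1 : Type := Lp ℂ 2 (volume : Measure S1)

/-- The point `v(φ) = (cos φ, sin φ)` of the unit circle in `ℝ²`. -/
def velocity (φ : S1) : EuclideanSpace ℝ (Fin 2) :=
  !₂[Real.Angle.cos φ, Real.Angle.sin φ]

/-- The mode `n = (n₁, n₂) ∈ ℤ²` as a vector of the Euclidean plane; `‖modeVec n‖` is the
Euclidean norm `|n|`. -/
def modeVec (n : Fin 2 → ℤ) : EuclideanSpace ℝ (Fin 2) :=
  !₂[(n 0 : ℝ), (n 1 : ℝ)]

theorem continuous_velocity : Continuous velocity := by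
  have hc : Continuous fun φ : S1 => Real.Angle.cos φ := Real.Angle.continuous_cos
  have hs : Continuous fun φ : S1 => Real.Angle.sin φ := Real.Angle.continuous_sin
  refine (PiLp.continuous_toLp 2 _).comp ?_
  refine continuous_pi fun i => ?_
  fin_cases i
  · exact hc
  · exact hs

/-- The constant function `1` in `L²(𝕊¹)`. -/
def oneL2 : L2S1 := ContinuousMap.toLp 2 volume ℂ (1 : C(S1, ℂ))

/-- The mean `φ̃ = (2π)⁻¹ ∫_{𝕊¹} φ dv`, as a bounded functional on `L²(𝕊¹)`
(see `velocityMean_apply`). -/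
def velocityMean : L2S1 →L[ℂ] ℂ :=
  ((2 * Real.pi : ℝ) : ℂ)⁻¹ • innerSL ℂ oneL2

/-- The collision part `R φ = φ - φ̃`. -/
def R : L2S1 →L[ℂ] L2S1 :=
  1 - velocityMean.smulRight oneL2

/-- The multiplier `v ↦ -i (v · n)`. -/
def transportSymbol (n : Fin 2 → ℤ) : C(S1, ℂ) where
  toFun φ := -Complex.I * ((⟪velocity φ, modeVec n⟫_ℝ : ℝ) : ℂ)
  continuous_toFun := by
    have := continuous_velocity
    fun_prop

/-- The transport part `(J_n φ)(v) = -i (v · n) φ(v)` (see `J_apply_ae`). -/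
def J (n : Fin 2 → ℤ) : L2S1 →L[ℂ] L2S1 :=
  (ContinuousLinearMap.mul ℂ ℂ).holderL volume ∞ 2 2
    (ContinuousMap.toLp ∞ volume ℂ (transportSymbol n))

/-- The modal operator `C_n = R - J_n`. -/
def C (n : Fin 2 → ℤ) : L2S1 →L[ℂ] L2S1 := R - J n

/-- The propagator `P_n(t) = e^{-C_n t}`. -/
def P (n : Fin 2 → ℤ) (t : ℝ) : L2S1 →L[ℂ] L2S1 :=
  NormedSpace.exp (-(t • C n))

/-- `f` solves the modal equation `∂ₜ f = -(R - J_n) f` for `t > 0` and is continuous up to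
`t = 0`; values at negative times play no role. -/
def IsModeSolution (n : Fin 2 → ℤ) (f : ℝ → L2S1) : Prop :=
  ContinuousOn f (Set.Ici 0) ∧ ∀ t : ℝ, 0 < t → HasDerivAt f (-(C n (f t))) t

/-- The decay rate `λ₀ = 1/2 - 1/(6√2) - (1/3) √(7/16 + 1/√8)`. -/
def rate : ℝ :=
  1 / 2 - 1 / (6 * √2) - 1 / 3 * √(7 / 16 + 1 / √8)

theorem velocityMean_apply (φ : L2S1) :
    velocityMean φ = ((2 * Real.pi : ℝ) : ℂ)⁻¹ * ∫ v, φ v := by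
  have h : ⟪oneL2, φ⟫_ℂ = ∫ v, φ v := by
    rw [L2.inner_def]
    refine integral_congr_ae ?_
    filter_upwards [ContinuousMap.coeFn_toLp (𝕜 := ℂ) (p := 2) (volume : Measure S1)
      (1 : C(S1, ℂ))] with v hv
    rw [oneL2, hv]
    simp
  simp [velocityMean, h]

theorem R_apply_ae (φ : L2S1) :
    R φ =ᵐ[volume] fun v => φ v - ((2 * Real.pi : ℝ) : ℂ)⁻¹ * ∫ w, φ w := by
  rw [← velocityMean_apply]
  have h : R φ = φ - velocityMean φ • oneL2 := by simp [R]
  rw [h]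
  filter_upwards [Lp.coeFn_sub φ (velocityMean φ • oneL2),
    Lp.coeFn_smul (velocityMean φ) oneL2,
    ContinuousMap.coeFn_toLp (𝕜 := ℂ) (p := 2) (volume : Measure S1) (1 : C(S1, ℂ))]
    with v h1 h2 h3
  rw [h1, Pi.sub_apply, h2, Pi.smul_apply, oneL2, h3]
  simp

theorem J_apply_ae (n : Fin 2 → ℤ) (φ : L2S1) :
    J n φ =ᵐ[volume]
      fun v => -Complex.I * ((⟪velocity v, modeVec n⟫_ℝ : ℝ) : ℂ) * φ v := by
  have h : J n φ = (ContinuousLinearMap.mul ℂ ℂ).holder 2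
      (ContinuousMap.toLp ∞ volume ℂ (transportSymbol n)) φ := rfl
  rw [h]
  filter_upwards [ContinuousLinearMap.coeFn_holder (r := 2) (ContinuousLinearMap.mul ℂ ℂ)
      (ContinuousMap.toLp ∞ volume ℂ (transportSymbol n)) φ,
    ContinuousMap.coeFn_toLp (𝕜 := ℂ) (p := ∞) (volume : Measure S1) (transportSymbol n)]
    with v h1 h2
  rw [h1, h2]
  rfl

end

end Lorentz

/-! The collision operator is the projection off the constants, so it damps everything except the
constant mode `e`. Transport rotates `e` into the first harmonic `w`, which is damped, and this
coupling has strength proportional to |n| ≥ 1. Only three facts about transport matter: skewness,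
its value on `e`, and its value on `w`, which is `e` plus a remainder `u` orthogonal to `e`. These
are collected in `IsModalSystem`. Constants that do not depend on n arise because k = |n| enters the
estimates only through k ≥ 1.

For (a), pairing `T x` with `w` recovers ⟪e, x⟫ from `K (T x)` and `K x`.

For (b) and (c), ‖f‖² dissipates only ‖K f‖², while the derivative of `coupling` contains the
missing term √2 k |⟪e, f⟫|². Subtracting `coupling` / (2k) from ‖f‖² gives an equivalent functional
that decays exponentially. For short times, integrating the derivative of `coupling` against a
weight that vanishes at both ends of [0, t] bounds the `e` component by the total dissipation. The
weight costs powers of t, and what remains is a loss of order t³. -/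

namespace Lorentz

/-! ### Modal systems: algebra and the basic coercivity estimate -/

section Abstract

variable {H : Type*} [NormedAddCommGroup H] [InnerProductSpace ℂ H]

/-- The first three modes `e`, `w`, `u` of a skew-adjoint transport operator `T` of strength `k`
and a collision operator `K` which is the projection onto the orthogonal complement of `e`. -/
structure IsModalSystem (k : ℝ) (e w u : H) (K T : H →L[ℂ] H) : Prop where
  one_le : 1 ≤ k
  norm_e : ‖e‖ = 1
  norm_w : ‖w‖ = 1
  norm_u : ‖u‖ ≤ √2
  inner_e_w : ⟪e, w⟫_ℂ = 0
  inner_e_u : ⟪e, u⟫_ℂ = 0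
  collision : ∀ x, K x = x - ⟪e, x⟫_ℂ • e
  skew : ∀ x y, ⟪T x, y⟫_ℂ = -⟪x, T y⟫_ℂ
  transport_e : T e = (-Complex.I * (k / √2 : ℝ)) • w
  transport_w : T w = (-Complex.I * (k / √2 : ℝ)) • e + (-Complex.I * (k / 2 : ℝ)) • u

/-- The quadratic form `2 Im (⟪e, x⟫ * conj ⟪w, x⟫)` coupling the first two modes. -/
noncomputable def coupling (e w x : H) : ℝ :=
  2 * ((⟪e, x⟫_ℂ).im * (⟪w, x⟫_ℂ).re - (⟪e, x⟫_ℂ).re * (⟪w, x⟫_ℂ).im)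

theorem abs_im_mul_re_sub_le (z v : ℂ) : |z.im * v.re - z.re * v.im| ≤ ‖z‖ * ‖v‖ := by
  have h : z.im * v.re - z.re * v.im = (z * (starRingEnd ℂ) v).im := by
    simp; ring
  rw [h]
  refine (Complex.abs_im_le_norm _).trans ?_
  simp

theorem abs_re_mul_re_add_le (z v : ℂ) : |z.re * v.re + z.im * v.im| ≤ ‖z‖ * ‖v‖ := by
  have h : z.re * v.re + z.im * v.im = (z * (starRingEnd ℂ) v).re := by
    simp
  rw [h]
  refine (Complex.abs_re_le_norm _).trans ?_
  simp

theorem abs_coupling_le (e w x : H) : |coupling e w x| ≤ 2 * (‖⟪e, x⟫_ℂ‖ * ‖⟪w, x⟫_ℂ‖) := by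
  rw [coupling, abs_mul, abs_of_pos two_pos]
  exact mul_le_mul_of_nonneg_left (abs_im_mul_re_sub_le _ _) two_pos.le

namespace IsModalSystem

variable {k : ℝ} {e w u : H} {K T : H →L[ℂ] H}

theorem inner_e_collision (h : IsModalSystem k e w u K T) (x : H) : ⟪e, K x⟫_ℂ = 0 := by
  rw [h.collision, inner_sub_right, inner_smul_right, inner_self_eq_norm_sq_to_K, h.norm_e]
  simp

/-- This is what lets the coefficients along `w` and `u` be controlled by the dissipated part `K x`
alone. -/
theorem inner_collision_of_orthogonal (h : IsModalSystem k e w u K T) {y : H}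
    (hy : ⟪e, y⟫_ℂ = 0) (x : H) : ⟪y, K x⟫_ℂ = ⟪y, x⟫_ℂ := by
  rw [h.collision, inner_sub_right, inner_smul_right, ← inner_conj_symm y e, hy]
  simp

theorem collision_idem (h : IsModalSystem k e w u K T) (x : H) : K (K x) = K x := by
  rw [h.collision (K x), h.inner_e_collision, zero_smul, sub_zero]

theorem collision_symm (h : IsModalSystem k e w u K T) (x y : H) :
    ⟪K x, y⟫_ℂ = ⟪x, K y⟫_ℂ := by
  rw [h.collision, h.collision, inner_sub_left, inner_sub_right, inner_smul_left,
    inner_smul_right, inner_conj_symm]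
  ring

theorem inner_collision_self (h : IsModalSystem k e w u K T) (x : H) :
    ⟪K x, x⟫_ℂ = ((‖K x‖ ^ 2 : ℝ) : ℂ) := by
  rw [← h.collision_idem, h.collision_symm, h.collision_idem, inner_self_eq_norm_sq_to_K]
  simp

theorem norm_sq_eq (h : IsModalSystem k e w u K T) (x : H) :
    ‖x‖ ^ 2 = ‖⟪e, x⟫_ℂ‖ ^ 2 + ‖K x‖ ^ 2 := by
  have hx : x = ⟪e, x⟫_ℂ • e + K x := by rw [h.collision]; abel
  have h0 : ⟪⟪e, x⟫_ℂ • e, K x⟫_ℂ = 0 := by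
    rw [inner_smul_left, h.inner_e_collision, mul_zero]
  have h1 := norm_add_sq_eq_norm_sq_add_norm_sq_of_inner_eq_zero _ _ h0
  rw [← hx, norm_smul, h.norm_e, mul_one] at h1
  nlinarith [h1]

theorem norm_inner_w_le (h : IsModalSystem k e w u K T) (x : H) : ‖⟪w, x⟫_ℂ‖ ≤ ‖K x‖ := by
  rw [← h.inner_collision_of_orthogonal h.inner_e_w]
  simpa [h.norm_w] using norm_inner_le_norm (𝕜 := ℂ) w (K x)

theorem norm_inner_u_le (h : IsModalSystem k e w u K T) (x : H) :
    ‖⟪u, x⟫_ℂ‖ ≤ √2 * ‖K x‖ := by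
  rw [← h.inner_collision_of_orthogonal h.inner_e_u]
  exact (norm_inner_le_norm (𝕜 := ℂ) u (K x)).trans
    (mul_le_mul_of_nonneg_right h.norm_u (norm_nonneg _))

theorem inner_e_transport (h : IsModalSystem k e w u K T) (x : H) :
    ⟪e, T x⟫_ℂ = -Complex.I * (k / √2 : ℝ) * ⟪w, x⟫_ℂ := by
  rw [← neg_eq_iff_eq_neg.mpr (h.skew e x), h.transport_e, inner_smul_left]
  simp only [map_mul, map_neg, Complex.conj_I, Complex.conj_ofReal]
  ring

theorem inner_w_transport (h : IsModalSystem k e w u K T) (x : H) :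
    ⟪w, T x⟫_ℂ = -Complex.I * (k / √2 : ℝ) * ⟪e, x⟫_ℂ - Complex.I * (k / 2 : ℝ) * ⟪u, x⟫_ℂ := by
  rw [← neg_eq_iff_eq_neg.mpr (h.skew w x), h.transport_w, inner_add_left, inner_smul_left,
    inner_smul_left]
  simp only [map_mul, map_neg, Complex.conj_I, Complex.conj_ofReal]
  ring

theorem re_inner_transport_self (h : IsModalSystem k e w u K T) (x : H) :
    (⟪T x, x⟫_ℂ).re = 0 := by
  have h1 := congrArg Complex.re (h.skew x x)
  have h2 : (⟪x, T x⟫_ℂ).re = (⟪T x, x⟫_ℂ).re := by rw [← inner_conj_symm, Complex.conj_re]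
  rw [Complex.neg_re, h2] at h1
  linarith

theorem re_inner_generator_self (h : IsModalSystem k e w u K T) (x : H) :
    (⟪(K - T) x, x⟫_ℂ).re = ‖K x‖ ^ 2 := by
  rw [sub_apply, inner_sub_left, h.inner_collision_self, Complex.sub_re,
    h.re_inner_transport_self, Complex.ofReal_re, sub_zero]

/-- The identity for ⟪w, T x⟫ is solved for ⟪e, x⟫, the only component that `K x` misses. -/
theorem norm_sq_le (h : IsModalSystem k e w u K T) (x : H) :
    ‖x‖ ^ 2 ≤ 3 * ‖K x‖ ^ 2 + 4 * ‖K (T x)‖ ^ 2 := by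
  have hk := h.one_le
  have hs : √2 * √2 = 2 := Real.mul_self_sqrt (by norm_num)
  have hs0 : 0 < √2 := by positivity
  have h1 : ‖⟪w, T x⟫_ℂ‖ ≤ ‖K (T x)‖ := h.norm_inner_w_le (T x)
  have h2 : Complex.I * (k / √2 : ℝ) * ⟪e, x⟫_ℂ
      = -⟪w, T x⟫_ℂ - Complex.I * (k / 2 : ℝ) * ⟪u, x⟫_ℂ := by
    rw [h.inner_w_transport]; ring
  have h3 : k / √2 * ‖⟪e, x⟫_ℂ‖ ≤ ‖⟪w, T x⟫_ℂ‖ + k / 2 * ‖⟪u, x⟫_ℂ‖ := by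
    have h4 := norm_sub_le (-⟪w, T x⟫_ℂ) (Complex.I * (k / 2 : ℝ) * ⟪u, x⟫_ℂ)
    rw [← h2] at h4
    simpa only [norm_mul, norm_neg, Complex.norm_I, one_mul, Complex.norm_real, Real.norm_eq_abs,
      abs_of_nonneg (show 0 ≤ k / √2 by positivity),
      abs_of_nonneg (show 0 ≤ k / 2 by positivity)] using h4
  have h5 : k / 2 * ‖⟪u, x⟫_ℂ‖ ≤ k / 2 * (√2 * ‖K x‖) :=
    mul_le_mul_of_nonneg_left (h.norm_inner_u_le x) (by positivity)
  -- Inserting k ≥ 1 here puts a factor k on every term, so that it cancels in `h10`.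
  have h6 : ‖K (T x)‖ ≤ k * ‖K (T x)‖ := le_mul_of_one_le_left (norm_nonneg _) hk
  have h7 : k * ‖⟪e, x⟫_ℂ‖ ≤ k * (√2 * ‖K (T x)‖ + ‖K x‖) := by
    have h8 : √2 * (k / √2 * ‖⟪e, x⟫_ℂ‖) = k * ‖⟪e, x⟫_ℂ‖ := by field_simp
    rw [← h8]
    have h9 : √2 * (k / √2 * ‖⟪e, x⟫_ℂ‖) ≤ √2 * (k * ‖K (T x)‖ + k / 2 * (√2 * ‖K x‖)) :=
      mul_le_mul_of_nonneg_left (by linarith) hs0.le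
    refine h9.trans_eq ?_
    linear_combination k / 2 * ‖K x‖ * hs
  have h10 : ‖⟪e, x⟫_ℂ‖ ≤ √2 * ‖K (T x)‖ + ‖K x‖ :=
    le_of_mul_le_mul_left h7 (by linarith)
  have h11 : ‖⟪e, x⟫_ℂ‖ ^ 2 ≤ (√2 * ‖K (T x)‖ + ‖K x‖) ^ 2 :=
    pow_le_pow_left₀ (norm_nonneg _) h10 2
  rw [h.norm_sq_eq]
  -- (p + q)² ≤ 2p² + 2q² with p = √2 ‖K (T x)‖ and q = ‖K x‖ gives 4 and 2; the third ‖K x‖² comes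
  -- from `norm_sq_eq`.
  nlinarith [sq_nonneg (√2 * ‖K (T x)‖ - ‖K x‖)]

section Adjoint

variable [CompleteSpace H]

theorem adjoint_transport (h : IsModalSystem k e w u K T) : T.adjoint = -T := by
  refine (ContinuousLinearMap.eq_adjoint_iff _ _).mpr (fun x y => ?_) |>.symm
  rw [neg_apply, inner_neg_left, h.skew, neg_neg]

theorem adjoint_collision (h : IsModalSystem k e w u K T) : K.adjoint = K :=
  ((ContinuousLinearMap.eq_adjoint_iff _ _).mpr h.collision_symm).symm

theorem hermitianPart_generator (h : IsModalSystem k e w u K T) :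
    hermitianPart (K - T) = K := by
  rw [hermitianPart, map_sub, h.adjoint_transport, h.adjoint_collision]
  ext x
  simp only [smul_apply, add_apply, sub_apply,
    neg_apply]
  module

end Adjoint

end IsModalSystem

end Abstract

end Lorentz

/-! ### Numerical enclosure of the rate -/

namespace Lorentz

theorem rate_bounds : 0.08565 < rate ∧ rate < 0.08575 := by
  have h1 : 1.41421 < √2 := Real.lt_sqrt_of_sq_lt (by norm_num)
  have h2 : √2 < 1.41422 := by rw [Real.sqrt_lt' (by norm_num)]; norm_num
  have hs : √2 * √2 = 2 := Real.mul_self_sqrt (by norm_num)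
  have h8 : √8 = 2 * √2 := by
    rw [show (8 : ℝ) = 2 ^ 2 * 2 by norm_num, Real.sqrt_mul (by norm_num),
      Real.sqrt_sq (by norm_num)]
  have e1 : 1 / (6 * √2) = √2 / 12 := by
    field_simp
    nlinarith
  have e2 : 1 / √8 = √2 / 4 := by
    rw [h8]; field_simp
    nlinarith
  have h3 : 0.8894 < √(7 / 16 + √2 / 4) :=
    Real.lt_sqrt_of_sq_lt (by nlinarith)
  have h4 : √(7 / 16 + √2 / 4) < 0.88943 := by
    rw [Real.sqrt_lt' (by norm_num)]; nlinarith
  rw [rate, e1, e2]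
  constructor <;> linarith

section Abstract

variable {H : Type*} [NormedAddCommGroup H] [InnerProductSpace ℂ H]

namespace IsModalSystem

variable {k : ℝ} {e w u : H} {K T : H →L[ℂ] H}

/-! ### Loewner bounds and the hypocoercivity index -/

section Adjoint

variable [CompleteSpace H]

theorem reApplyInnerSelf_conj_collision (h : IsModalSystem k e w u K T) (S : H →L[ℂ] H) (x : H) :
    (⟪(S.adjoint * K * S) x, x⟫_ℂ).re = ‖K (S x)‖ ^ 2 := by
  change (⟪S.adjoint (K (S x)), x⟫_ℂ).re = _
  rw [ContinuousLinearMap.adjoint_inner_left, h.inner_collision_self, Complex.ofReal_re]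

theorem isSelfAdjoint_collision (h : IsModalSystem k e w u K T) : IsSelfAdjoint K :=
  h.adjoint_collision

theorem coercive_transport (h : IsModalSystem k e w u K T) :
    ((1 / 4 : ℝ) : ℂ) • (1 : H →L[ℂ] H) ≤ K + T * K * T.adjoint := by
  rw [ContinuousLinearMap.le_def, ContinuousLinearMap.isPositive_def']
  constructor
  · refine IsSelfAdjoint.sub (h.isSelfAdjoint_collision.add ?_) ?_
    · exact h.isSelfAdjoint_collision.conjugate T
    · exact IsSelfAdjoint.smul (Complex.conj_ofReal _) (IsSelfAdjoint.one _)
  · intro x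
    have h1 := h.reApplyInnerSelf_conj_collision T.adjoint x
    rw [ContinuousLinearMap.adjoint_adjoint] at h1
    have h2 : ‖K (T.adjoint x)‖ = ‖K (T x)‖ := by
      rw [h.adjoint_transport, neg_apply, map_neg, norm_neg]
    have h3 := h.norm_sq_le x
    have h4 : (⟪x, x⟫_ℂ).re = ‖x‖ ^ 2 := by
      rw [inner_self_eq_norm_sq_to_K]; norm_cast
    rw [ContinuousLinearMap.reApplyInnerSelf_apply, sub_apply, add_apply, smul_apply, one_apply_eq_self,
      inner_sub_left, inner_add_left, inner_smul_left, Complex.conj_ofReal]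
    simp only [RCLike.re_to_complex, Complex.sub_re, Complex.add_re, h1, h.inner_collision_self,
      Complex.ofReal_re, Complex.re_ofReal_mul, h2, h4]
    nlinarith [sq_nonneg ‖K (T x)‖, sq_nonneg ‖K x‖]

theorem hypocoerciveUpTo_one (h : IsModalSystem k e w u K T) : HypocoerciveUpTo (K - T) 1 := by
  -- Since K T = K - K (K - T), `norm_sq_le` becomes ‖x‖² ≤ 11 ‖K x‖² + 8 ‖K (K - T) x‖²; any κ ≤
  -- 1/11 would do.
  refine ⟨1 / 16, by norm_num, ?_⟩
  rw [h.hermitianPart_generator, Finset.sum_range_succ, Finset.sum_range_one, pow_zero, pow_zero,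
    pow_one, pow_one, one_mul, mul_one, ContinuousLinearMap.le_def,
    ContinuousLinearMap.isPositive_def']
  constructor
  · refine IsSelfAdjoint.sub (h.isSelfAdjoint_collision.add ?_) ?_
    · exact h.isSelfAdjoint_collision.conjugate' (K - T)
    · exact IsSelfAdjoint.smul (Complex.conj_ofReal _) (IsSelfAdjoint.one _)
  · intro x
    have h1 := h.reApplyInnerSelf_conj_collision (K - T) x
    have h3 := h.norm_sq_le x
    have h4 : (⟪x, x⟫_ℂ).re = ‖x‖ ^ 2 := by
      rw [inner_self_eq_norm_sq_to_K]; norm_cast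
    have h5 : ‖K (T x)‖ ≤ ‖K x‖ + ‖K ((K - T) x)‖ := by
      have h6 : K (T x) = K x - K ((K - T) x) := by
        rw [sub_apply, map_sub, h.collision_idem, sub_sub_cancel]
      rw [h6]
      exact norm_sub_le _ _
    have h7 := pow_le_pow_left₀ (norm_nonneg _) h5 2
    rw [ContinuousLinearMap.reApplyInnerSelf_apply, sub_apply, add_apply, smul_apply, one_apply_eq_self,
      inner_sub_left, inner_add_left, inner_smul_left, Complex.conj_ofReal]
    simp only [RCLike.re_to_complex, Complex.sub_re, Complex.add_re, h1, h.inner_collision_self,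
      Complex.ofReal_re, Complex.re_ofReal_mul, h4]
    nlinarith [sq_nonneg (‖K x‖ - ‖K ((K - T) x)‖), sq_nonneg ‖K x‖, sq_nonneg ‖K ((K - T) x)‖]

/-- The Hermitian part of the generator is `K`, which annihilates `e`. -/
theorem not_hypocoerciveUpTo_zero (h : IsModalSystem k e w u K T) :
    ¬HypocoerciveUpTo (K - T) 0 := by
  rintro ⟨c, hc, hle⟩
  rw [h.hermitianPart_generator, Finset.sum_range_one, pow_zero, pow_zero, one_mul, mul_one,
    ContinuousLinearMap.le_def, ContinuousLinearMap.isPositive_def'] at hle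
  have h1 := hle.2 e
  have h2 : (⟪e, e⟫_ℂ).re = 1 := by
    rw [inner_self_eq_norm_sq_to_K, h.norm_e]; simp
  have h3 : K e = 0 := by
    rw [h.collision, inner_self_eq_norm_sq_to_K, h.norm_e]; simp
  rw [ContinuousLinearMap.reApplyInnerSelf_apply, sub_apply, smul_apply, one_apply_eq_self, h3, zero_sub,
    inner_neg_left, inner_smul_left, Complex.conj_ofReal] at h1
  simp only [RCLike.re_to_complex, Complex.neg_re, Complex.re_ofReal_mul, h2] at h1
  linarith

theorem hasHypocoercivityIndex_one (h : IsModalSystem k e w u K T) :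
    HasHypocoercivityIndex (K - T) 1 := by
  refine ⟨fun x => ?_, h.hypocoerciveUpTo_one, fun m hm => ?_⟩
  · rw [h.re_inner_generator_self]
    positivity
  · by_contra hlt
    obtain rfl : m = 0 := by omega
    exact h.not_hypocoerciveUpTo_zero hm

end Adjoint

/-! ### Time derivatives along solutions -/

section Evolution

variable [NormedSpace ℝ H] {f : ℝ → H} {s : ℝ}

theorem hasDerivAt_norm_sq (h : IsModalSystem k e w u K T)
    (hf : HasDerivAt f (-((K - T) (f s))) s) :
    HasDerivAt (fun r => ‖f r‖ ^ 2) (-2 * ‖K (f s)‖ ^ 2) s := by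
  have h1 := Complex.reCLM.hasFDerivAt.comp_hasDerivAt s (hf.inner ℂ hf)
  have h2 : (fun r => ‖f r‖ ^ 2) = Complex.reCLM ∘ fun r => ⟪f r, f r⟫_ℂ := by
    funext r
    simp only [Function.comp_apply, Complex.reCLM_apply]
    rw [inner_self_eq_norm_sq_to_K]
    norm_cast
  rw [h2]
  refine h1.congr_deriv ?_
  have h3 := h.re_inner_generator_self (f s)
  have h4 : (⟪f s, (K - T) (f s)⟫_ℂ).re = ‖K (f s)‖ ^ 2 := by
    rw [← h3, ← inner_conj_symm, Complex.conj_re]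
  simp only [Complex.reCLM_apply, inner_neg_left, inner_neg_right, Complex.add_re, Complex.neg_re,
    h3, h4]
  ring

/-- The `e` and `w` coefficients a, b satisfy a' = -i(k/√2) b and b' = -b - i(k/√2) a - i(k/2) c,
with c the `u` coefficient. No equation for c is needed, because ‖K f‖ bounds it. -/
theorem hasDerivAt_coupling (h : IsModalSystem k e w u K T)
    (hf : HasDerivAt f (-((K - T) (f s))) s) :
    HasDerivAt (fun r => coupling e w (f r))
      (k * (√2 * (‖⟪e, f s⟫_ℂ‖ ^ 2 - ‖⟪w, f s⟫_ℂ‖ ^ 2)) - coupling e w (f s)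
        + k * ((⟪e, f s⟫_ℂ).re * (⟪u, f s⟫_ℂ).re + (⟪e, f s⟫_ℂ).im * (⟪u, f s⟫_ℂ).im)) s := by
  have hd (y : H) : HasDerivAt (fun r => ⟪y, f r⟫_ℂ) ⟪y, -((K - T) (f s))⟫_ℂ s := by
    exact ((hasDerivAt_const s y).inner ℂ hf).congr_deriv (by rw [inner_zero_left, add_zero])
  have hre (y : H) := Complex.reCLM.hasFDerivAt.comp_hasDerivAt s (hd y)
  have him (y : H) := Complex.imCLM.hasFDerivAt.comp_hasDerivAt s (hd y)
  have h1 := (((him e).mul (hre w)).sub ((hre e).mul (him w))).const_mul 2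
  refine h1.congr_deriv ?_
  have ha : ⟪e, -((K - T) (f s))⟫_ℂ = -Complex.I * (k / √2 : ℝ) * ⟪w, f s⟫_ℂ := by
    rw [inner_neg_right, sub_apply, inner_sub_right, h.inner_e_collision, h.inner_e_transport]
    ring
  have hb : ⟪w, -((K - T) (f s))⟫_ℂ = -⟪w, f s⟫_ℂ - Complex.I * (k / √2 : ℝ) * ⟪e, f s⟫_ℂ
      - Complex.I * (k / 2 : ℝ) * ⟪u, f s⟫_ℂ := by
    rw [inner_neg_right, sub_apply, inner_sub_right,
      h.inner_collision_of_orthogonal h.inner_e_w, h.inner_w_transport]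
    ring
  have hk : k / √2 = k * √2 / 2 := by
    have hs : √2 * √2 = 2 := Real.mul_self_sqrt (by norm_num)
    rw [div_eq_iff (by positivity)]
    linear_combination -(k / 2) * hs
  rw [ha, hb, hk]
  simp only [Function.comp_apply, Complex.reCLM_apply, Complex.imCLM_apply, Complex.sub_re,
    Complex.sub_im, Complex.neg_re, Complex.neg_im, Complex.mul_re, Complex.mul_im,
    Complex.I_re, Complex.I_im, Complex.ofReal_re, Complex.ofReal_im, coupling,
    ← Complex.normSq_eq_norm_sq, Complex.normSq_apply]
  ring

end Evolution

end IsModalSystem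

end Abstract

/-! ### Scalar inequalities behind the two decay estimates -/

/-- Here A, B, c are the sizes of the `e`, `w`, `u` coefficients, G = ‖K f‖, Q the coupling and S
its `u` term. After B ≤ G and k ≥ 1 the left side is at most a quadratic form in A and G, negative
definite with room to spare for l in this interval. -/
theorem entropy_production_le {k l A B G c Q S : ℝ} (hk : 1 ≤ k) (hA : 0 ≤ A) (hB : 0 ≤ B)
    (hBG : B ≤ G) (hc : c ≤ √2 * G) (hQ : |Q| ≤ 2 * (A * B)) (hS : |S| ≤ A * c)
    (hl : 0.0856 < l) (hl' : l < 0.0858) :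
    2 * l * (A ^ 2 + G ^ 2 - Q / (2 * k))
      + (-2 * G ^ 2 - (k * (√2 * (A ^ 2 - B ^ 2)) - Q + k * S) / (2 * k)) ≤ 0 := by
  have h1 : 1.4142 < √2 := Real.lt_sqrt_of_sq_lt (by norm_num)
  have h2 : √2 < 1.41422 := by rw [Real.sqrt_lt' (by norm_num)]; norm_num
  have hG : 0 ≤ G := hB.trans hBG
  have hAG : 0 ≤ A * G := mul_nonneg hA hG
  have hAB : A * B ≤ A * G := mul_le_mul_of_nonneg_left hBG hA
  have hQk : Q / k ≤ 2 * (A * G) :=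
    (div_le_iff₀ (by linarith)).2 (by nlinarith [le_abs_self Q])
  have hS' : -S ≤ A * (√2 * G) :=
    (neg_le_abs S).trans (hS.trans (mul_le_mul_of_nonneg_left hc hA))
  have hB2 : B ^ 2 ≤ G ^ 2 := pow_le_pow_left₀ hB hBG 2
  have e : 2 * l * (A ^ 2 + G ^ 2 - Q / (2 * k))
      + (-2 * G ^ 2 - (k * (√2 * (A ^ 2 - B ^ 2)) - Q + k * S) / (2 * k))
      = (2 * l - √2 / 2) * A ^ 2 + (2 * l - 2) * G ^ 2 + √2 / 2 * B ^ 2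
        + (1 / 2 - l) * (Q / k) + (1 / 2) * (-S) := by
    field_simp
    ring
  rw [e]
  have t1 : (1 / 2 - l) * (Q / k) ≤ (1 / 2 - l) * (2 * (A * G)) :=
    mul_le_mul_of_nonneg_left hQk (by linarith)
  have t2 : √2 / 2 * B ^ 2 ≤ √2 / 2 * G ^ 2 := mul_le_mul_of_nonneg_left hB2 (by positivity)
  have t3 : (2 * l - √2 / 2) * A ^ 2 ≤ -0.5355 * A ^ 2 :=
    mul_le_mul_of_nonneg_right (by linarith) (sq_nonneg A)
  have t4 : (2 * l - 2 + √2 / 2) * G ^ 2 ≤ -1.1212 * G ^ 2 :=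
    mul_le_mul_of_nonneg_right (by linarith) (sq_nonneg G)
  have t5 : (1 - 2 * l + √2 / 2) * (A * G) ≤ 1.53592 * (A * G) :=
    mul_le_mul_of_nonneg_right (by linarith) hAG
  -- Completing the square: 1.4342 slightly exceeds 1.53592 / (2 · 0.5355), and 0.5355 · 1.4342² <
  -- 1.1212.
  nlinarith [sq_nonneg (A - 1.4342 * G), sq_nonneg G]

/-- With η = s(t - s), the right side is the derivative of η² Q / k. Squaring η makes the term from
differentiating the weight a product of ηA and tG, so it can be absorbed by (ηA)² and (tG)². -/
theorem weighted_coupling_deriv_ge {k s t A B G c Q S : ℝ} (hk : 1 ≤ k) (hA : 0 ≤ A) (hB : 0 ≤ B)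
    (hBG : B ≤ G) (hc : c ≤ √2 * G) (hQ : |Q| ≤ 2 * (A * B)) (hS : |S| ≤ A * c)
    (hs : 0 ≤ s) (hst : s ≤ t) (ht : t ≤ 1) :
    (s * (t - s)) ^ 2 * A ^ 2 / 2 - 20 * t ^ 2 * G ^ 2 ≤
      (2 * (s * (t - s)) * (t - 2 * s) * Q
        + (s * (t - s)) ^ 2 * (k * (√2 * (A ^ 2 - B ^ 2)) - Q + k * S)) / k := by
  have h1 : 1.4142 < √2 := Real.lt_sqrt_of_sq_lt (by norm_num)
  have h2 : √2 < 1.41422 := by rw [Real.sqrt_lt' (by norm_num)]; norm_num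
  have hG : 0 ≤ G := hB.trans hBG
  have hAB : A * B ≤ A * G := mul_le_mul_of_nonneg_left hBG hA
  have ht0 : 0 ≤ t := hs.trans hst
  have hη0 : 0 ≤ s * (t - s) := mul_nonneg hs (by linarith)
  have hηt : s * (t - s) ≤ t / 4 := by nlinarith [sq_nonneg (t - 2 * s)]
  have hη' : |t - 2 * s| ≤ t := by rw [abs_le]; constructor <;> linarith
  set η := s * (t - s) with hη
  have hQk : |Q / k| ≤ 2 * (A * G) := by
    rw [abs_div, abs_of_pos (show 0 < k by linarith), div_le_iff₀ (by linarith)]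
    have := le_mul_of_one_le_right (mul_nonneg hA hG) hk
    linarith
  have hS' : -S ≤ A * (√2 * G) :=
    (neg_le_abs S).trans (hS.trans (mul_le_mul_of_nonneg_left hc hA))
  have hB2 : B ^ 2 ≤ G ^ 2 := pow_le_pow_left₀ hB hBG 2
  have e : (2 * η * (t - 2 * s) * Q + η ^ 2 * (k * (√2 * (A ^ 2 - B ^ 2)) - Q + k * S)) / k
      = 2 * η * ((t - 2 * s) * (Q / k)) + η ^ 2 * (√2 * (A ^ 2 - B ^ 2) - Q / k + S) := by
    have : k ≠ 0 := by linarith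
    field_simp
  rw [e]
  have t1 : -(t * (2 * (A * G))) ≤ (t - 2 * s) * (Q / k) := by
    refine (neg_le_neg ?_).trans (neg_abs_le _)
    rw [abs_mul]
    exact mul_le_mul hη' hQk (abs_nonneg _) ht0
  have t2 : √2 * A ^ 2 - √2 * G ^ 2 - 2 * (A * G) - A * (√2 * G)
      ≤ √2 * (A ^ 2 - B ^ 2) - Q / k + S := by
    have := mul_le_mul_of_nonneg_left hB2 (Real.sqrt_nonneg 2)
    have := (le_abs_self _).trans hQk
    linarith
  have t3 := mul_le_mul_of_nonneg_left t1 (show 0 ≤ 2 * η by linarith)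
  have t4 := mul_le_mul_of_nonneg_left t2 (sq_nonneg η)
  have hZ : η * G ≤ t * G / 4 := by
    have := mul_le_mul_of_nonneg_right hηt hG
    linarith
  have hZ0 : 0 ≤ η * G := mul_nonneg hη0 hG
  have hX0 : 0 ≤ η * A := mul_nonneg hη0 hA
  have t5 : (η * A) * (η * G) ≤ (η * A) * (t * G / 4) := mul_le_mul_of_nonneg_left hZ hX0
  have t6 : (η * G) ^ 2 ≤ (t * G / 4) ^ 2 := pow_le_pow_left₀ hZ0 hZ 2
  have t7 : √2 * (η * G) ^ 2 ≤ 2 * (t * G / 4) ^ 2 :=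
    mul_le_mul (by linarith) t6 (sq_nonneg _) two_pos.le
  have t8 : (2 + √2) * ((η * A) * (η * G)) ≤ 4 * ((η * A) * (t * G / 4)) :=
    mul_le_mul (by linarith) t5 (mul_nonneg hX0 hZ0) four_pos.le
  have t9 : 1.4142 * (η * A) ^ 2 ≤ √2 * (η * A) ^ 2 :=
    mul_le_mul_of_nonneg_right h1.le (sq_nonneg _)
  -- With X = ηA and Y = tG, what remains is 0.9142 X² - 5XY + 19.875 Y² ≥ 0.
  linarith [sq_nonneg (η * A - 3 * (t * G)), sq_nonneg (t * G), sq_nonneg (η * A)]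

end Lorentz

/-! ### Long-time and short-time decay of solutions -/

namespace Lorentz

section Abstract

variable {H : Type*} [NormedAddCommGroup H] [InnerProductSpace ℂ H]

namespace IsModalSystem

variable {k : ℝ} {e w u : H} {K T : H →L[ℂ] H} {f : ℝ → H}

theorem continuousOn_coupling {S : Set ℝ} (hc : ContinuousOn f S) :
    ContinuousOn (fun r => coupling e w (f r)) S := by
  have hd (y : H) : ContinuousOn (fun r => ⟪y, f r⟫_ℂ) S := continuousOn_const.inner hc
  have hre (y : H) := Complex.continuous_re.comp_continuousOn (hd y)
  have him (y : H) := Complex.continuous_im.comp_continuousOn (hd y)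
  exact continuousOn_const.mul (((him e).mul (hre w)).sub ((hre e).mul (him w)))

theorem abs_coupling_le_norm_sq (h : IsModalSystem k e w u K T) (x : H) :
    |coupling e w x| ≤ ‖x‖ ^ 2 := by
  have h1 := abs_coupling_le e w x
  have h2 := h.norm_inner_w_le x
  have h3 := h.norm_sq_eq x
  have h4 : ‖⟪w, x⟫_ℂ‖ ^ 2 ≤ ‖K x‖ ^ 2 := pow_le_pow_left₀ (norm_nonneg _) h2 2
  nlinarith [sq_nonneg (‖⟪e, x⟫_ℂ‖ - ‖⟪w, x⟫_ℂ‖)]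

variable [NormedSpace ℝ H]

theorem antitoneOn_norm_sq (h : IsModalSystem k e w u K T) (hc : ContinuousOn f (Set.Ici 0))
    (hf : ∀ s, 0 < s → HasDerivAt f (-((K - T) (f s))) s) :
    AntitoneOn (fun r => ‖f r‖ ^ 2) (Set.Ici 0) := by
  refine antitoneOn_of_hasDerivWithinAt_nonpos (convex_Ici 0) (hc.norm.pow 2)
    (f' := fun s => -2 * ‖K (f s)‖ ^ 2) (fun s hs => ?_) fun s _ => ?_
  · rw [interior_Ici] at hs
    exact (h.hasDerivAt_norm_sq (hf s hs)).hasDerivWithinAt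
  · nlinarith [sq_nonneg ‖K (f s)‖]

theorem antitoneOn_entropy (h : IsModalSystem k e w u K T) (hc : ContinuousOn f (Set.Ici 0))
    (hf : ∀ s, 0 < s → HasDerivAt f (-((K - T) (f s))) s) :
    AntitoneOn (fun r => Real.exp (2 * rate * r) * (‖f r‖ ^ 2 - coupling e w (f r) / (2 * k)))
      (Set.Ici 0) := by
  have hexp (s : ℝ) : HasDerivAt (fun r => Real.exp (2 * rate * r))
      (Real.exp (2 * rate * s) * (2 * rate)) s := by
    simpa using ((hasDerivAt_id s).const_mul (2 * rate)).exp
  have hd (s : ℝ) (hs : 0 < s) :=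
    (hexp s).mul ((h.hasDerivAt_norm_sq (hf s hs)).sub
      ((h.hasDerivAt_coupling (hf s hs)).div_const (2 * k)))
  refine antitoneOn_of_hasDerivWithinAt_nonpos (convex_Ici 0) ?_
    (fun s hs => (hd s (by rwa [interior_Ici] at hs)).hasDerivWithinAt) fun s _ => ?_
  · exact (by fun_prop : Continuous fun r : ℝ => Real.exp (2 * rate * r)).continuousOn.mul
      ((hc.norm.pow 2).sub ((continuousOn_coupling hc).div_const _))
  · have h1 := entropy_production_le h.one_le (norm_nonneg ⟪e, f s⟫_ℂ) (norm_nonneg _)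
      (h.norm_inner_w_le (f s)) (h.norm_inner_u_le (f s)) (abs_coupling_le e w (f s))
      (abs_re_mul_re_add_le ⟪e, f s⟫_ℂ ⟪u, f s⟫_ℂ) (l := rate)
      (by linarith [rate_bounds.1]) (by linarith [rate_bounds.2])
    rw [← h.norm_sq_eq] at h1
    have h2 := mul_nonpos_of_nonneg_of_nonpos (Real.exp_pos (2 * rate * s)).le h1
    refine le_of_eq_of_le ?_ h2
    simp only [Pi.sub_apply]
    ring

/-- As |`coupling`| ≤ ‖x‖², the modified functional lies between (1 ∓ 1/(2k)) ‖x‖²; the prefactor is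
the ratio of these bounds. -/
theorem norm_sq_le_exp (h : IsModalSystem k e w u K T) (hc : ContinuousOn f (Set.Ici 0))
    (hf : ∀ s, 0 < s → HasDerivAt f (-((K - T) (f s))) s) {t : ℝ} (ht : 0 ≤ t) :
    ‖f t‖ ^ 2 ≤ (2 * k + 1) / (2 * k - 1) * Real.exp (-rate * t) ^ 2 * ‖f 0‖ ^ 2 := by
  have hk := h.one_le
  have h1 := h.antitoneOn_entropy hc hf Set.self_mem_Ici ht ht
  simp only [mul_zero, Real.exp_zero, one_mul] at h1
  have hlow : (2 * k - 1) * ‖f t‖ ^ 2 ≤ 2 * k * (‖f t‖ ^ 2 - coupling e w (f t) / (2 * k)) := by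
    have h2 := (le_abs_self _).trans (h.abs_coupling_le_norm_sq (f t))
    have h3 : 2 * k * (coupling e w (f t) / (2 * k)) = coupling e w (f t) := by field_simp
    linarith
  have hup : 2 * k * (‖f 0‖ ^ 2 - coupling e w (f 0) / (2 * k)) ≤ (2 * k + 1) * ‖f 0‖ ^ 2 := by
    have h2 := (neg_le_abs _).trans (h.abs_coupling_le_norm_sq (f 0))
    have h3 : 2 * k * (coupling e w (f 0) / (2 * k)) = coupling e w (f 0) := by field_simp
    linarith
  have hE : Real.exp (-rate * t) ^ 2 * Real.exp (2 * rate * t) = 1 := by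
    rw [← Real.exp_nat_mul, ← Real.exp_add, Real.exp_eq_one_iff]
    push_cast
    ring
  have hE2 : 0 ≤ Real.exp (-rate * t) ^ 2 := by positivity
  rw [div_mul_eq_mul_div, div_mul_eq_mul_div, le_div_iff₀ (by linarith)]
  calc ‖f t‖ ^ 2 * (2 * k - 1) ≤ 2 * k * (‖f t‖ ^ 2 - coupling e w (f t) / (2 * k)) := by linarith
    _ = 2 * k * (Real.exp (-rate * t) ^ 2 *
        (Real.exp (2 * rate * t) * (‖f t‖ ^ 2 - coupling e w (f t) / (2 * k)))) := by
      rw [← mul_assoc (Real.exp (-rate * t) ^ 2), hE, one_mul]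
    _ ≤ 2 * k * (Real.exp (-rate * t) ^ 2 * (‖f 0‖ ^ 2 - coupling e w (f 0) / (2 * k))) := by
      gcongr
    _ = Real.exp (-rate * t) ^ 2 * (2 * k * (‖f 0‖ ^ 2 - coupling e w (f 0) / (2 * k))) := by ring
    _ ≤ Real.exp (-rate * t) ^ 2 * ((2 * k + 1) * ‖f 0‖ ^ 2) :=
      mul_le_mul_of_nonneg_left hup hE2
    _ = _ := by ring

theorem norm_sq_mul_le (h : IsModalSystem k e w u K T) (hc : ContinuousOn f (Set.Ici 0))
    (hf : ∀ s, 0 < s → HasDerivAt f (-((K - T) (f s))) s) {t : ℝ} (ht : 0 ≤ t) (ht1 : t ≤ 1) :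
    ‖f t‖ ^ 2 * (1 + t ^ 3 / 630) ≤ ‖f 0‖ ^ 2 := by
  have hk := h.one_le
  rcases ht.eq_or_lt with rfl | htpos
  · simp
  have hη (s : ℝ) : HasDerivAt (fun r => (r * (t - r)) ^ 2)
      (2 * (s * (t - s)) * (t - 2 * s)) s := by
    refine (((hasDerivAt_id s).mul ((hasDerivAt_id s).const_sub t)).pow 2).congr_deriv ?_
    simp only [id_eq, Pi.mul_apply]
    ring
  -- The antiderivative of η²/2 that vanishes at 0; its value at t is t⁵/60.
  have hp (s : ℝ) : HasDerivAt
      (fun r => t ^ 2 * r ^ 3 / 6 - t * r ^ 4 / 4 + r ^ 5 / 10) ((s * (t - s)) ^ 2 / 2) s := by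
    refine (((((hasDerivAt_id s).pow 3).const_mul (t ^ 2)).div_const 6).sub
      ((((hasDerivAt_id s).pow 4).const_mul t).div_const 4) |>.add
      (((hasDerivAt_id s).pow 5).div_const 10)).congr_deriv ?_
    simp
    ring
  have hd (s : ℝ) (hs : 0 < s) :=
    ((((hη s).mul (h.hasDerivAt_coupling (hf s hs))).div_const k).sub
      ((h.hasDerivAt_norm_sq (hf s hs)).const_mul (21 / 2 * t ^ 2))).sub
      ((hp s).const_mul (‖f t‖ ^ 2))
  have hcI : ContinuousOn f (Set.Icc 0 t) := hc.mono Set.Icc_subset_Ici_self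
  -- Since ‖f‖² dissipates at rate 2 ‖K f‖², the factor 21/2 supplies 21 t² ‖K f‖²: 20 for the
  -- weighted coupling, 1 for the part of η² ‖f t‖² / 2 ≤ η² ‖f s‖² / 2 lying in ‖K f‖².
  have hmono : MonotoneOn (fun r => (r * (t - r)) ^ 2 * coupling e w (f r) / k
      - 21 / 2 * t ^ 2 * ‖f r‖ ^ 2
      - ‖f t‖ ^ 2 * (t ^ 2 * r ^ 3 / 6 - t * r ^ 4 / 4 + r ^ 5 / 10)) (Set.Icc 0 t) := by
    refine monotoneOn_of_hasDerivWithinAt_nonneg (convex_Icc 0 t) ?_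
      (fun s hs => (hd s (by rw [interior_Icc] at hs; exact hs.1)).hasDerivWithinAt) fun s hs => ?_
    · refine ContinuousOn.sub (ContinuousOn.sub (ContinuousOn.div_const (ContinuousOn.mul ?_
        (continuousOn_coupling hcI)) _) (continuousOn_const.mul (hcI.norm.pow 2))) ?_
      · exact (by fun_prop : Continuous fun r : ℝ => (r * (t - r)) ^ 2).continuousOn
      · exact (by fun_prop : Continuous fun r : ℝ =>
          ‖f t‖ ^ 2 * (t ^ 2 * r ^ 3 / 6 - t * r ^ 4 / 4 + r ^ 5 / 10)).continuousOn
    · rw [interior_Icc] at hs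
      have h1 := weighted_coupling_deriv_ge h.one_le (norm_nonneg ⟪e, f s⟫_ℂ) (norm_nonneg _)
        (h.norm_inner_w_le (f s)) (h.norm_inner_u_le (f s)) (abs_coupling_le e w (f s))
        (abs_re_mul_re_add_le ⟪e, f s⟫_ℂ ⟪u, f s⟫_ℂ) hs.1.le hs.2.le ht1
      have h2 := h.antitoneOn_norm_sq hc hf hs.1.le ht hs.2.le
      have h3 := h.norm_sq_eq (f s)
      simp only at h2
      have h4 : (s * (t - s)) ^ 2 * ‖f t‖ ^ 2 ≤
          (s * (t - s)) ^ 2 * (‖⟪e, f s⟫_ℂ‖ ^ 2 + ‖K (f s)‖ ^ 2) := by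
        rw [← h3]
        exact mul_le_mul_of_nonneg_left h2 (sq_nonneg _)
      have h5 : (s * (t - s)) ^ 2 ≤ t ^ 2 := by
        have h6 : 0 ≤ t - s := by linarith [hs.2]
        have h7 : s * (t - s) ≤ t := by nlinarith [hs.1, hs.2]
        exact pow_le_pow_left₀ (mul_nonneg hs.1.le h6) h7 2
      have h8 := mul_le_mul_of_nonneg_right h5 (sq_nonneg ‖K (f s)‖)
      have h9 : 0 ≤ t ^ 2 * ‖K (f s)‖ ^ 2 := by positivity
      linarith
  have h1 := hmono (Set.left_mem_Icc.2 ht) (Set.right_mem_Icc.2 ht) ht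
  have ht2 : 0 < t ^ 2 := by positivity
  simp only at h1
  refine le_of_mul_le_mul_left ?_ (show 0 < 21 / 2 * t ^ 2 by positivity)
  -- The weight vanishes at 0 and t, so the coupling drops out; 630 = 60 · 21/2.
  ring_nf at h1 ⊢
  linarith

theorem norm_le_one_sub (h : IsModalSystem k e w u K T) (hc : ContinuousOn f (Set.Ici 0))
    (hf : ∀ s, 0 < s → HasDerivAt f (-((K - T) (f s))) s) {t : ℝ} (ht : 0 ≤ t) (ht1 : t ≤ 1) :
    ‖f t‖ ≤ (1 - 1 / 2520 * t ^ 3) * ‖f 0‖ := by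
  have h1 := h.norm_sq_mul_le hc hf ht ht1
  have ht3 : t ^ 3 ≤ 1 := pow_le_one₀ ht ht1
  have ht0 : 0 ≤ t ^ 3 := by positivity
  set y := t ^ 3 with hy
  -- 2520 = 4 · 630: half of the first-order gain 1/1260 is given up to absorb the higher powers of
  -- y.
  have h2 : 1 ≤ (1 - 1 / 2520 * y) ^ 2 * (1 + y / 630) := by
    nlinarith [mul_nonneg ht0 ht0,
      mul_nonneg ht0 (mul_nonneg ht0 ht0)]
  refine (sq_le_sq₀ (norm_nonneg _) (mul_nonneg (by linarith) (norm_nonneg _))).1 ?_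
  rw [mul_pow]
  calc ‖f t‖ ^ 2 ≤ ‖f t‖ ^ 2 * ((1 - 1 / 2520 * y) ^ 2 * (1 + y / 630)) :=
        le_mul_of_one_le_right (sq_nonneg _) h2
    _ = (1 - 1 / 2520 * y) ^ 2 * (‖f t‖ ^ 2 * (1 + y / 630)) := by ring
    _ ≤ _ := mul_le_mul_of_nonneg_left h1 (sq_nonneg _)

end IsModalSystem

end Abstract

end Lorentz

/-! ### The modal system on the circle -/

namespace Lorentz

theorem inner_velocity_modeVec (n : Fin 2 → ℤ) (φ : ℝ) :
    ⟪velocity (φ : S1), modeVec n⟫_ℝ = n 0 * Real.cos φ + n 1 * Real.sin φ := by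
  have hc : Real.Angle.cos (φ : S1) = Real.cos φ := Real.Angle.cos_coe φ
  have hs : Real.Angle.sin (φ : S1) = Real.sin φ := Real.Angle.sin_coe φ
  simp [velocity, modeVec, PiLp.inner_apply, Fin.sum_univ_two, hc, hs]

theorem norm_modeVec_sq (n : Fin 2 → ℤ) : ‖modeVec n‖ ^ 2 = (n 0 : ℝ) ^ 2 + (n 1 : ℝ) ^ 2 := by
  simp [EuclideanSpace.norm_sq_eq, modeVec, Fin.sum_univ_two]

theorem norm_velocity (φ : S1) : ‖velocity φ‖ = 1 := by
  induction φ using QuotientAddGroup.induction_on with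
  | H φ =>
    have hc : Real.Angle.cos (φ : S1) = Real.cos φ := Real.Angle.cos_coe φ
    have hs : Real.Angle.sin (φ : S1) = Real.sin φ := Real.Angle.sin_coe φ
    simp [EuclideanSpace.norm_eq, velocity, Fin.sum_univ_two, hc, hs]

theorem one_le_norm_modeVec {n : Fin 2 → ℤ} (hn : n ≠ 0) : 1 ≤ ‖modeVec n‖ := by
  have h : (1 : ℤ) ≤ n 0 ^ 2 + n 1 ^ 2 := by
    by_contra hlt
    have h0 : n 0 = 0 := by nlinarith [sq_nonneg (n 0), sq_nonneg (n 1)]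
    have h1 : n 1 = 0 := by nlinarith [sq_nonneg (n 0), sq_nonneg (n 1)]
    exact hn (funext fun i => by fin_cases i <;> simpa)
  have h2 : (1 : ℝ) ≤ ‖modeVec n‖ ^ 2 := by
    rw [norm_modeVec_sq]
    exact_mod_cast h
  exact (one_le_sq_iff₀ (norm_nonneg _)).1 h2

theorem integral_inner_velocity (n : Fin 2 → ℤ) :
    ∫ φ : S1, ⟪velocity φ, modeVec n⟫_ℝ = 0 := by
  rw [← AddCircle.intervalIntegral_preimage (2 * Real.pi) 0]
  simp only [inner_velocity_modeVec, zero_add]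
  rw [intervalIntegral.integral_add (by apply Continuous.intervalIntegrable; fun_prop)
    (by apply Continuous.intervalIntegrable; fun_prop)]
  simp

theorem integral_inner_velocity_sq (n : Fin 2 → ℤ) :
    ∫ φ : S1, ⟪velocity φ, modeVec n⟫_ℝ ^ 2 = Real.pi * ‖modeVec n‖ ^ 2 := by
  rw [← AddCircle.intervalIntegral_preimage (2 * Real.pi) 0]
  simp only [inner_velocity_modeVec, zero_add, norm_modeVec_sq]
  have e (x : ℝ) : (n 0 * Real.cos x + n 1 * Real.sin x) ^ 2 = (n 0 : ℝ) ^ 2 * Real.cos x ^ 2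
      + (2 * n 0 * n 1 * (Real.sin x * Real.cos x) + (n 1 : ℝ) ^ 2 * Real.sin x ^ 2) := by ring
  simp only [e]
  rw [intervalIntegral.integral_add (by apply Continuous.intervalIntegrable; fun_prop)
    (by apply Continuous.intervalIntegrable; fun_prop),
    intervalIntegral.integral_add (by apply Continuous.intervalIntegrable; fun_prop)
    (by apply Continuous.intervalIntegrable; fun_prop)]
  simp only [intervalIntegral.integral_const_mul, integral_cos_sq, integral_sin_sq,
    integral_sin_mul_cos₁]
  simp
  ring

theorem oneL2_ae : oneL2 =ᵐ[volume] fun _ => (1 : ℂ) :=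
  ContinuousMap.coeFn_toLp (𝕜 := ℂ) (p := 2) (volume : Measure S1) (1 : C(S1, ℂ))

theorem inner_oneL2_oneL2 : ⟪oneL2, oneL2⟫_ℂ = ((2 * Real.pi : ℝ) : ℂ) := by
  rw [L2.inner_def]
  have h : (fun v => ⟪oneL2 v, oneL2 v⟫_ℂ) =ᵐ[volume] fun _ : S1 => (1 : ℂ) := by
    filter_upwards [oneL2_ae] with v hv
    simp [hv]
  rw [integral_congr_ae h, integral_const, Measure.real, AddCircle.measure_univ]
  simp [Real.pi_pos.le]

theorem J_skew (n : Fin 2 → ℤ) (x y : L2S1) : ⟪J n x, y⟫_ℂ = -⟪x, J n y⟫_ℂ := by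
  rw [L2.inner_def, L2.inner_def, ← integral_neg]
  refine integral_congr_ae ?_
  filter_upwards [J_apply_ae n x, J_apply_ae n y] with v hx hy
  simp only [hx, hy, RCLike.inner_apply, map_mul, map_neg, Complex.conj_I, Complex.conj_ofReal]
  ring

theorem inner_oneL2_J_oneL2 (n : Fin 2 → ℤ) : ⟪oneL2, J n oneL2⟫_ℂ = 0 := by
  rw [L2.inner_def]
  have h : (fun v => ⟪oneL2 v, J n oneL2 v⟫_ℂ) =ᵐ[volume]
      fun v => -Complex.I * ((⟪velocity v, modeVec n⟫_ℝ : ℝ) : ℂ) := by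
    filter_upwards [oneL2_ae, J_apply_ae n oneL2] with v hv hJ
    simp [hv, hJ]
  rw [integral_congr_ae h, integral_const_mul, integral_complex_ofReal, integral_inner_velocity]
  simp

theorem inner_J_oneL2_J_oneL2 (n : Fin 2 → ℤ) :
    ⟪J n oneL2, J n oneL2⟫_ℂ = ((Real.pi * ‖modeVec n‖ ^ 2 : ℝ) : ℂ) := by
  rw [L2.inner_def]
  have h : (fun v => ⟪J n oneL2 v, J n oneL2 v⟫_ℂ) =ᵐ[volume]
      fun v => ((⟪velocity v, modeVec n⟫_ℝ ^ 2 : ℝ) : ℂ) := by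
    filter_upwards [oneL2_ae, J_apply_ae n oneL2] with v hv hJ
    simp only [hJ, hv, RCLike.inner_apply, map_mul, map_neg, Complex.conj_I, Complex.conj_ofReal,
      map_one]
    push_cast
    linear_combination (-((⟪velocity v, modeVec n⟫_ℝ : ℝ) : ℂ) ^ 2) * Complex.I_mul_I
  rw [integral_congr_ae h, integral_complex_ofReal, integral_inner_velocity_sq]

theorem norm_J_apply_le (n : Fin 2 → ℤ) (x : L2S1) : ‖J n x‖ ≤ ‖modeVec n‖ * ‖x‖ := by
  refine Lp.norm_le_mul_norm_of_ae_le_mul ?_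
  filter_upwards [J_apply_ae n x] with v hv
  rw [hv, norm_mul, norm_mul, norm_neg, Complex.norm_I, one_mul, Complex.norm_real]
  refine mul_le_mul_of_nonneg_right ?_ (norm_nonneg _)
  simpa [norm_velocity] using norm_inner_le_norm (𝕜 := ℝ) (velocity v) (modeVec n)

theorem exists_isModalSystem {n : Fin 2 → ℤ} (hn : n ≠ 0) :
    ∃ e w u : L2S1, IsModalSystem ‖modeVec n‖ e w u R (J n) := by
  have hk := one_le_norm_modeVec hn
  set k := ‖modeVec n‖ with hkdef
  have hk0 : 0 < k := by linarith
  have hkC : (k : ℂ) ≠ 0 := by exact_mod_cast hk0.ne'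
  have hπ := Real.pi_pos
  have hs : √2 * √2 = 2 := Real.mul_self_sqrt (by norm_num)
  have hsC : (√2 : ℂ) * √2 = 2 := by exact_mod_cast hs
  have hs0 : (√2 : ℂ) ≠ 0 := by
    intro h0; rw [h0] at hsC; norm_num at hsC
  have hp : √(2 * Real.pi) * √(2 * Real.pi) = 2 * Real.pi := Real.mul_self_sqrt (by positivity)
  have hpC : (√(2 * Real.pi) : ℂ) * √(2 * Real.pi) = 2 * Real.pi := by exact_mod_cast hp
  have hp0 : (√(2 * Real.pi) : ℂ) ≠ 0 := by
    have : √(2 * Real.pi) ≠ 0 := by positivity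
    exact_mod_cast this
  -- With θ the angle between v and n, `w` is √2 cos θ times `e`, and `u` is what remains of the
  -- rescaled `J n w` after removing its `e` component.
  let e : L2S1 := ((√(2 * Real.pi) : ℂ)⁻¹) • oneL2
  let w : L2S1 := (Complex.I * (√2 : ℂ) * (k : ℂ)⁻¹) • J n e
  let u : L2S1 := (2 * Complex.I * (k : ℂ)⁻¹) • J n w - (√2 : ℂ) • e
  have he : ⟪e, e⟫_ℂ = 1 := by
    simp only [e, inner_smul_left, inner_smul_right, inner_oneL2_oneL2, map_inv₀,
      Complex.conj_ofReal]
    push_cast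
    field_simp
    linear_combination -hpC
  have heJ : ⟪e, J n e⟫_ℂ = 0 := by
    simp only [e, map_smul, inner_smul_left, inner_smul_right, inner_oneL2_J_oneL2, mul_zero]
  have hJJ : ⟪J n e, J n e⟫_ℂ = (k : ℂ) ^ 2 / 2 := by
    simp only [e, map_smul, inner_smul_left, inner_smul_right, inner_J_oneL2_J_oneL2, map_inv₀,
      Complex.conj_ofReal, ← hkdef]
    push_cast
    field_simp
    linear_combination -hpC
  have hww : ⟪w, w⟫_ℂ = 1 := by
    simp only [w, inner_smul_left, inner_smul_right, hJJ, map_mul, map_inv₀, Complex.conj_I,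
      Complex.conj_ofReal]
    field_simp
    linear_combination (-Complex.I ^ 2) * hsC - 2 * Complex.I_sq
  have hJe : J n e = (-Complex.I * (k / √2 : ℝ)) • w := by
    simp only [w, smul_smul]
    push_cast
    rw [show -Complex.I * ((k : ℂ) / √2) * (Complex.I * √2 * (k : ℂ)⁻¹) = 1 by
      field_simp
      linear_combination -Complex.I_sq, one_smul]
  have hJw : J n w = (-Complex.I * (k / √2 : ℝ)) • e + (-Complex.I * (k / 2 : ℝ)) • u := by
    simp only [u, smul_sub, smul_smul]
    push_cast
    rw [show -Complex.I * ((k : ℂ) / 2) * (2 * Complex.I * (k : ℂ)⁻¹) = 1 by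
        field_simp
        linear_combination -Complex.I_sq, one_smul,
      show -Complex.I * ((k : ℂ) / 2) * √2 = -Complex.I * ((k : ℂ) / √2) by
        field_simp
        linear_combination -hsC]
    abel
  have hew : ⟪e, w⟫_ℂ = 0 := by simp only [w, inner_smul_right, heJ, mul_zero]
  have heJw : ⟪e, J n w⟫_ℂ = -Complex.I * (k / √2 : ℝ) := by
    rw [← neg_eq_iff_eq_neg.mpr (J_skew n e w), hJe, inner_smul_left, hww]
    simp
  have heu : ⟪e, u⟫_ℂ = 0 := by
    simp only [u, inner_sub_right, inner_smul_right, heJw, he]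
    push_cast
    field_simp
    linear_combination (-2) * Complex.I_sq - hsC
  have norm_of (x : L2S1) (hx : ⟪x, x⟫_ℂ = 1) : ‖x‖ = 1 := by
    rw [norm_eq_sqrt_re_inner (𝕜 := ℂ), hx]; simp
  have hwn := norm_of w hww
  have hen := norm_of e he
  -- Pythagoras: ‖J n w‖ ≤ k bounds the rescaled vector by 2, and its `e` part has norm √2, so ‖u‖²
  -- ≤ 4 - 2.
  have hun : ‖u‖ ≤ √2 := by
    have h1 : (2 * Complex.I * (k : ℂ)⁻¹) • J n w = (√2 : ℂ) • e + u := by simp only [u]; abel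
    have h2 := norm_add_sq_eq_norm_sq_add_norm_sq_of_inner_eq_zero ((√2 : ℂ) • e) u
      (by rw [inner_smul_left, heu, mul_zero])
    rw [← h1, norm_smul, norm_smul, hen] at h2
    simp only [norm_mul, norm_inv, Complex.norm_real, Complex.norm_I, Complex.norm_ofNat,
      Real.norm_eq_abs, abs_of_pos hk0, abs_of_nonneg (Real.sqrt_nonneg 2), mul_one, hs] at h2
    have h3 : 2 * k⁻¹ * ‖J n w‖ ≤ 2 := by
      have h4 := norm_J_apply_le n w
      rw [hwn, mul_one, ← hkdef] at h4
      calc 2 * k⁻¹ * ‖J n w‖ ≤ 2 * k⁻¹ * k := by gcongr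
        _ = 2 := by field_simp
    have h5 : 0 ≤ 2 * k⁻¹ * ‖J n w‖ := by positivity
    refine Real.le_sqrt_of_sq_le ?_
    nlinarith
  refine ⟨e, w, u, hk, hen, hwn, hun, hew, heu, fun x => ?_, J_skew n, hJe, hJw⟩
  have h1 : R x = x - velocityMean x • oneL2 := by simp [R]
  rw [h1]
  congr 1
  simp only [velocityMean, e, smul_apply, innerSL_apply_apply, inner_smul_left, smul_smul,
    smul_eq_mul, map_inv₀, Complex.conj_ofReal]
  congr 1
  push_cast
  rw [← hpC]
  field_simp

end Lorentz

/-! ### The propagator and the final assembly -/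

theorem Lorentz.hasDerivAt_P_apply (n : Fin 2 → ℤ) (x : Lorentz.L2S1) (t : ℝ) :
    HasDerivAt (fun s => Lorentz.P n s x)
      (-((Lorentz.R - Lorentz.J n) (Lorentz.P n t x))) t := by
  have h1 : HasDerivAt (fun s => Lorentz.P n s) (-Lorentz.C n * Lorentz.P n t) t := by
    have e (s : ℝ) : Lorentz.P n s = NormedSpace.exp (s • -Lorentz.C n) := by
      rw [Lorentz.P, smul_neg]
    simp only [e]
    exact hasDerivAt_exp_smul_const' (𝕂 := ℝ) (-Lorentz.C n) t
  refine (((ContinuousLinearMap.apply ℂ L2S1 x).restrictScalars ℝ).hasFDerivAt.comp_hasDerivAt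
    t h1).congr_deriv ?_
  simp [Lorentz.C]

theorem mainTheorem8 :
    -- (a) the hypocoercivity index of every mode is one, with a uniform coercivity estimate
    (∀ n : Fin 2 → ℤ, n ≠ 0 → HasHypocoercivityIndex (Lorentz.R - Lorentz.J n) 1) ∧
    (∃ κ : ℝ, 0 < κ ∧ ∀ n : Fin 2 → ℤ, n ≠ 0 →
      (κ : ℂ) • (1 : Lorentz.L2S1 →L[ℂ] Lorentz.L2S1) ≤
        Lorentz.R + Lorentz.J n * Lorentz.R * (Lorentz.J n).adjoint) ∧
    -- (b) exponential decay of every solution of the modal equation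
    (∀ n : Fin 2 → ℤ, n ≠ 0 → ∀ f : ℝ → Lorentz.L2S1, Lorentz.IsModeSolution n f →
      ∀ t : ℝ, 0 ≤ t →
        ‖f t‖ ≤ min 1 (√((2 * ‖Lorentz.modeVec n‖ + 1) / (2 * ‖Lorentz.modeVec n‖ - 1)) *
            Real.exp (-Lorentz.rate * t)) * ‖f 0‖ ∧
        min 1 (√((2 * ‖Lorentz.modeVec n‖ + 1) / (2 * ‖Lorentz.modeVec n‖ - 1)) *
            Real.exp (-Lorentz.rate * t)) * ‖f 0‖ ≤
          √3 * Real.exp (-Lorentz.rate * t) * ‖f 0‖) ∧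
    |Lorentz.rate - 0.0857| < 0.00005 ∧
    -- (c) short-time decay of the propagator norm, uniformly in the mode
    (∃ c : ℝ, 0 < c ∧ ∃ τ : ℝ, 0 < τ ∧ ∀ n : Fin 2 → ℤ, n ≠ 0 →
      ∀ t : ℝ, 0 ≤ t → t ≤ τ → ‖Lorentz.P n t‖ ≤ 1 - c * t ^ 3) := by
  refine ⟨fun n hn => ?_, ⟨1 / 4, by norm_num, fun n hn => ?_⟩, fun n hn f hf t ht => ?_, ?_,
    1 / 2520, by norm_num, 1, one_pos, fun n hn t ht ht1 => ?_⟩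
  · obtain ⟨e, w, u, h⟩ := Lorentz.exists_isModalSystem hn
    exact h.hasHypocoercivityIndex_one
  · obtain ⟨e, w, u, h⟩ := Lorentz.exists_isModalSystem hn
    exact h.coercive_transport
  · obtain ⟨e, w, u, h⟩ := Lorentz.exists_isModalSystem hn
    have hk := h.one_le
    constructor
    · rw [min_mul_of_nonneg _ _ (norm_nonneg _), le_min_iff]
      constructor
      · rw [one_mul]
        exact (sq_le_sq₀ (norm_nonneg _) (norm_nonneg _)).1
          (h.antitoneOn_norm_sq hf.1 hf.2 Set.self_mem_Ici ht ht)
      · refine (sq_le_sq₀ (norm_nonneg _) (by positivity)).1 ?_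
        rw [mul_pow, mul_pow, Real.sq_sqrt (div_nonneg (by linarith) (by linarith))]
        exact h.norm_sq_le_exp hf.1 hf.2 ht
    · refine mul_le_mul_of_nonneg_right ((min_le_right _ _).trans
        (mul_le_mul_of_nonneg_right (Real.sqrt_le_sqrt ?_) (Real.exp_pos _).le)) (norm_nonneg _)
      -- (2k + 1)/(2k - 1) decreases in k and equals 3 at k = 1.
      rw [div_le_iff₀ (by linarith)]
      linarith
  · rw [abs_lt]
    constructor <;> linarith [Lorentz.rate_bounds.1, Lorentz.rate_bounds.2]
  · obtain ⟨e, w, u, h⟩ := Lorentz.exists_isModalSystem hn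
    have ht3 : t ^ 3 ≤ 1 := pow_le_one₀ ht ht1
    refine ContinuousLinearMap.opNorm_le_bound _ (by linarith) fun x => ?_
    have hd := Lorentz.hasDerivAt_P_apply n x
    have h1 := h.norm_le_one_sub (f := fun s => Lorentz.P n s x)
      (fun s _ => (hd s).continuousAt.continuousWithinAt) (fun s _ => hd s) ht ht1
    simpa [Lorentz.P] using h1
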